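/- An orientation of a finite simple graph $G$ is a digraph obtained by assigning exactly one direction to each edge of $G$. A directed dominating set of a digraph $D$ is a set $S$ of vertices such that every vertex $u \notin S$ is the head of an arc $(v,u)$ with $v \in S$; $\gamma(D)$ denotes the minimum cardinality of such a set. Let $\Gamma_d(G)$ denote the maximum of $\gamma(D)$ over all orientations $D$ of $G$. A graph is outerplanar if it can be drawn in the plane without crossings so that its vertices lie on a fixed circle and its edges are arcs in the closed disk bounded by that circle; it is maximal outerplanar if it is outerplanar and is not a proper spanning subgraph of another outerplanar graph on the same vertex set. Theorem. For every integer $n \ge 1$, $$\max\{\Gamma_d(G) : G \text{ is a maximal outerplanar graph of order } n\} = \left\lceil \frac{n}{2} \right\rceil .$$ -/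

import Mathlib

/-- `D` is an orientation of `G`: every edge of `G` receives exactly one direction,
and `D` has no other arcs. Here `D.Adj u v` means that `(u, v)` is an arc. -/
structure IsOrientation {V : Type*} (D : Digraph V) (G : SimpleGraph V) : Prop where
  adj_iff : ∀ u v, G.Adj u v ↔ D.Adj u v ∨ D.Adj v u
  asymm : ∀ u v, D.Adj u v → ¬ D.Adj v u

/-- `S` is a directed dominating set of `D`: every vertex outside `S` is the head of an arc
whose tail is in `S`. -/
def IsDirectedDominating {V : Type*} (D : Digraph V) (S : Finset V) : Prop :=
  ∀ u, u ∉ S → ∃ v ∈ S, D.Adj v u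

/-- The directed domination number of a digraph: the minimum cardinality of a directed
dominating set. -/
noncomputable def dirDomNumber {V : Type*} (D : Digraph V) : ℕ :=
  sInf {k | ∃ S : Finset V, IsDirectedDominating D S ∧ S.card = k}

/-- The (upper) directed domination number of a graph: the maximum of the directed domination
numbers of its orientations. -/
noncomputable def upperDirDomNumber {V : Type*} (G : SimpleGraph V) : ℕ :=
  sSup {k | ∃ D : Digraph V, IsOrientation D G ∧ dirDomNumber D = k}

/-- On a finite vertex set the minimum is attained. -/
theorem isLeast_dirDomNumber {V : Type*} [Fintype V] (D : Digraph V) :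
    IsLeast {k | ∃ S : Finset V, IsDirectedDominating D S ∧ S.card = k} (dirDomNumber D) := by
  have hne : {k | ∃ S : Finset V, IsDirectedDominating D S ∧ S.card = k}.Nonempty :=
    ⟨_, Finset.univ, fun u hu => absurd (Finset.mem_univ u) hu, rfl⟩
  exact ⟨Nat.sInf_mem hne, fun _ hk => Nat.sInf_le hk⟩

/-- Every graph has an orientation. -/
theorem exists_isOrientation {V : Type*} (G : SimpleGraph V) :
    ∃ D : Digraph V, IsOrientation D G := by
  classical
  refine ⟨⟨fun u v => G.Adj u v ∧ WellOrderingRel u v⟩, fun u v => ⟨fun h => ?_, ?_⟩, ?_⟩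
  · rcases trichotomous_of (WellOrderingRel (α := V)) u v with h' | h' | h'
    · exact Or.inl ⟨h, h'⟩
    · exact absurd h' h.ne
    · exact Or.inr ⟨h.symm, h'⟩
  · rintro (h | h)
    · exact h.1
    · exact h.1.symm
  · exact fun u v h h' => asymm_of (WellOrderingRel (α := V)) h.2 h'.2

/-- On a finite vertex set the maximum is attained. -/
theorem isGreatest_upperDirDomNumber {V : Type*} [Fintype V] (G : SimpleGraph V) :
    IsGreatest {k | ∃ D : Digraph V, IsOrientation D G ∧ dirDomNumber D = k}
      (upperDirDomNumber G) := by
  have hbdd : BddAbove {k | ∃ D : Digraph V, IsOrientation D G ∧ dirDomNumber D = k} := by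
    refine ⟨Fintype.card V, ?_⟩
    rintro k ⟨D, -, rfl⟩
    exact (isLeast_dirDomNumber D).2
      ⟨Finset.univ, fun u hu => absurd (Finset.mem_univ u) hu, rfl⟩
  obtain ⟨D, hD⟩ := exists_isOrientation G
  exact ⟨Nat.sSup_mem ⟨_, D, hD, rfl⟩ hbdd, fun _ hk => le_csSup hbdd hk⟩

/-- A crossing-free drawing of a graph in the closed unit disk of the plane with all vertices
on the bounding circle. Vertices are distinct points, edges are arcs (injective continuous images
of the unit interval) joining the points of their two ends, an edge passes through no vertex
other than its ends, and two different edges meet at most in common ends. -/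
structure OuterplanarDrawing {V : Type*} (G : SimpleGraph V) where
  /-- The position of a vertex. -/
  point : V → ℂ
  /-- A parametrization of the arc that represents an edge. -/
  curve : G.edgeSet → unitInterval → ℂ
  point_injective : Function.Injective point
  curve_continuous : ∀ e, Continuous (curve e)
  curve_injective : ∀ e, Function.Injective (curve e)
  curve_ends : ∀ e : G.edgeSet, s(curve e 0, curve e 1) = Sym2.map point e.1
  mem_of_point_eq_curve : ∀ (e : G.edgeSet) (v : V) (t : unitInterval),
    point v = curve e t → v ∈ e.1
  eq_point_of_curve_eq_curve : ∀ (e f : G.edgeSet) (s t : unitInterval), e ≠ f →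
    curve e s = curve f t → ∃ v, v ∈ e.1 ∧ v ∈ f.1 ∧ curve e s = point v
  norm_point : ∀ v, ‖point v‖ = 1
  norm_curve_le : ∀ e t, ‖curve e t‖ ≤ 1

/-- A graph is outerplanar if it can be drawn in the plane without crossings in such a way that
its vertices lie on a fixed circle and its edges lie in the disk bounded by that circle. -/
def IsOuterplanar {V : Type*} (G : SimpleGraph V) : Prop :=
  Nonempty (OuterplanarDrawing G)

/-- A maximal outerplanar graph: outerplanar, and not a proper spanning subgraph of any other
outerplanar graph on the same vertex set. -/
def IsMaximalOuterplanar {V : Type*} (G : SimpleGraph V) : Prop :=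
  Maximal (IsOuterplanar (V := V)) G

/-! ### Topology: disjoint arcs in the disk have non-alternating ends. -/

open Complex in
theorem one_sub_re_pos {w : ℂ} (hw : ‖w‖ ≤ 1) (h1 : w ≠ 1) : 0 < (1 - w).re := by
  rw [sub_re, one_re, sub_pos]
  refine lt_of_le_of_ne ((re_le_norm w).trans hw) fun h => h1 ?_
  have h2 : w.re ^ 2 + w.im ^ 2 ≤ 1 := by
    have := Complex.sq_norm w
    rw [normSq_apply] at this
    nlinarith [norm_nonneg w]
  apply Complex.ext
  · simpa using h
  · have : w.im ^ 2 ≤ 0 := by rw [h] at h2; linarith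
    simpa using this

-- This is the inscribed angle theorem, from 1 - e^{iθ} = 2 sin(θ/2) e^{i(θ-π)/2}. The jump by π at
-- θ = 0 is what later detects alternation.
open Complex in
theorem arg_one_sub_exp_of_pos {θ : ℝ} (h0 : 0 < θ) (h1 : θ < 2 * Real.pi) :
    arg (1 - exp (θ * I)) = (θ - Real.pi) / 2 := by
  have hs : 0 < 2 * Real.sin (θ / 2) := by
    have := Real.sin_pos_of_pos_of_lt_pi (x := θ / 2) (by linarith) (by linarith)
    linarith
  have key : 1 - exp (θ * I) = ((2 * Real.sin (θ / 2) : ℝ) : ℂ) *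
      (cos (((θ - Real.pi) / 2 : ℝ) : ℂ) + sin (((θ - Real.pi) / 2 : ℝ) : ℂ) * I) := by
    have e1 : (θ - Real.pi) / 2 = θ / 2 - Real.pi / 2 := by ring
    have e2 : θ = 2 * (θ / 2) := by ring
    rw [← ofReal_cos, ← ofReal_sin, e1, Real.cos_sub_pi_div_two, Real.sin_sub_pi_div_two,
      exp_mul_I, ← ofReal_cos, ← ofReal_sin]
    nth_rewrite 1 2 [e2]
    rw [Real.cos_two_mul, Real.sin_two_mul, Real.cos_sq']
    generalize Real.sin (θ / 2) = S
    generalize Real.cos (θ / 2) = C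
    apply Complex.ext <;>
      simp only [sub_re, sub_im, add_re, add_im, one_re, one_im, re_ofReal_mul, im_ofReal_mul,
        ofReal_re, ofReal_im, I_re, I_im] <;> ring
  rw [key, arg_mul_cos_add_sin_mul_I hs]
  constructor <;> linarith

open Complex in
theorem arg_one_sub_exp_of_neg {θ : ℝ} (h0 : θ < 0) (h1 : -(2 * Real.pi) < θ) :
    arg (1 - exp (θ * I)) = (θ + Real.pi) / 2 := by
  have h := arg_one_sub_exp_of_pos (θ := θ + 2 * Real.pi) (by linarith) (by linarith)
  rw [ofReal_add, add_mul, exp_add] at h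
  have : exp (((2 * Real.pi : ℝ) : ℂ) * I) = 1 := by
    push_cast
    exact exp_two_pi_mul_I
  rw [this, mul_one] at h
  rw [h]
  ring

open Complex in
/-- A continuous logarithm of `c - δ`, where `c` is on the unit circle and `δ` runs in the closed
unit disk, changes its imaginary part exactly as the principal argument of `1 - δ / c` does. -/
theorem im_sub_im_eq_arg_sub_arg {δ G : ℝ → ℂ} (hδ : Continuous δ) (hG : Continuous G)
    (hn : ∀ t, ‖δ t‖ ≤ 1) {α : ℝ} (hne : ∀ t, δ t ≠ exp (α * I)) {k : ℂ}
    (h : ∀ t, exp (G t) = k * (exp (α * I) - δ t)) (s t : ℝ) :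
    (G t).im - (G s).im =
      arg (1 - exp (-(α * I)) * δ t) - arg (1 - exp (-(α * I)) * δ s) := by
  set e := exp (-(α * I)) with he
  have hee : exp (α * I) * e = 1 := by rw [he, ← exp_add]; simp
  have hne' : ‖e‖ = 1 := by
    rw [he, show -((α : ℂ) * I) = ((-α : ℝ) : ℂ) * I by push_cast; ring, norm_exp_ofReal_mul_I]
  have hre : ∀ t, 0 < (1 - e * δ t).re := fun t => by
    apply one_sub_re_pos
    · rw [norm_mul, hne', one_mul]
      exact hn t
    · intro h1
      apply hne t
      calc δ t = (exp (α * I) * e) * δ t := by rw [hee, one_mul]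
        _ = exp (α * I) * (e * δ t) := by ring
        _ = _ := by rw [h1, mul_one]
  have hslit : ∀ t, 1 - e * δ t ∈ slitPlane := fun t => Or.inl (hre t)
  -- The difference of two continuous logarithms lifts a constant through the covering `exp`, hence
  -- is constant.
  have hL : Continuous fun t => G t - log (1 - e * δ t) :=
    hG.sub (Continuous.clog (by fun_prop) hslit)
  have hexp : ∀ t, exp (G t - log (1 - e * δ t)) = k * exp (α * I) := fun t => by
    have h0 := slitPlane_ne_zero (hslit t)
    rw [exp_sub, exp_log h0, h t, div_eq_iff h0]
    linear_combination (k * δ t) * hee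
  have hc := Complex.isCoveringMap_exp.const_of_comp hL
    (fun a a' => Subtype.ext (by simp only [hexp])) t s
  have := congrArg Complex.im hc
  simp only [sub_im, log_im] at this
  linarith

open Complex in
/-- Two paths in the closed unit disk whose ends alternate on the unit circle meet. -/
theorem noncrossing_of_paths_disjoint {γ δ : ℝ → ℂ} (hγ : Continuous γ) (hδ : Continuous δ)
    (hγn : ∀ t, ‖γ t‖ ≤ 1) (hδn : ∀ t, ‖δ t‖ ≤ 1) (hne : ∀ s t, γ s ≠ δ t) {a b c d : ℝ}
    (ha : a ∈ Set.Ico 0 (2 * Real.pi)) (hb : b ∈ Set.Ico 0 (2 * Real.pi))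
    (hc : c ∈ Set.Ico 0 (2 * Real.pi)) (hd : d ∈ Set.Ico 0 (2 * Real.pi))
    (hγ0 : γ 0 = exp (a * I)) (hγ1 : γ 1 = exp (b * I))
    (hδ0 : δ 0 = exp (c * I)) (hδ1 : δ 1 = exp (d * I)) :
    0 ≤ (c - a) * (c - b) * ((d - a) * (d - b)) := by
  -- For disjoint paths, γ s - δ t never vanishes, so on the simply connected plane it has a
  -- continuous logarithm F. Its imaginary part has total change zero around the unit square, and on
  -- each side one of the two points is a fixed point of the circle.
  let f : C(ℝ × ℝ, ℂ) := ⟨fun p => γ p.1 - δ p.2, by fun_prop⟩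
  have hf : ∀ p, f p ∈ ({0}ᶜ : Set ℂ) := fun p => sub_ne_zero.2 (hne p.1 p.2)
  obtain ⟨F, ⟨-, hF⟩, -⟩ := Complex.isCoveringMapOn_exp.existsUnique_continuousMap_lifts f
    (a₀ := (0, 0)) (e₀ := log (f (0, 0))) (exp_log (hf _)) hf
  have hF' : ∀ s t, exp (F (s, t)) = γ s - δ t := fun s t => congrFun hF (s, t)
  have ea := im_sub_im_eq_arg_sub_arg (G := fun t => F (0, t)) (k := 1) hδ (by fun_prop) hδn
    (α := a) (fun t => by rw [← hγ0]; exact (hne _ _).symm)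
    (fun t => by rw [hF', hγ0, one_mul]) 0 1
  have eb := im_sub_im_eq_arg_sub_arg (G := fun t => F (1, t)) (k := 1) hδ (by fun_prop) hδn
    (α := b) (fun t => by rw [← hγ1]; exact (hne _ _).symm)
    (fun t => by rw [hF', hγ1, one_mul]) 0 1
  have ec := im_sub_im_eq_arg_sub_arg (G := fun t => F (t, 0)) (k := -1) hγ (by fun_prop) hγn
    (α := c) (fun t => by rw [← hδ0]; exact hne _ _)
    (fun t => by rw [hF', hδ0]; ring) 0 1
  have ed := im_sub_im_eq_arg_sub_arg (G := fun t => F (t, 1)) (k := -1) hγ (by fun_prop) hγn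
    (α := d) (fun t => by rw [← hδ1]; exact hne _ _)
    (fun t => by rw [hF', hδ1]; ring) 0 1
  have hdiff : ∀ x y : ℝ, exp (-(x * I)) * exp (y * I) = exp (((y - x : ℝ) : ℂ) * I) := by
    intro x y
    rw [← exp_add]
    congr 1
    push_cast
    ring
  simp only [hγ0, hγ1, hδ0, hδ1, hdiff] at ea eb ec ed
  -- Here σ is the sign of y - x.
  have hval : ∀ x ∈ Set.Ico 0 (2 * Real.pi), ∀ y ∈ Set.Ico 0 (2 * Real.pi), x ≠ y →
      ∃ σ : ℝ, (σ = 1 ∨ σ = -1) ∧ 0 < σ * (y - x) ∧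
        arg (1 - exp (((y - x : ℝ) : ℂ) * I)) = ((y - x) - σ * Real.pi) / 2 ∧
        arg (1 - exp (((x - y : ℝ) : ℂ) * I)) = ((x - y) + σ * Real.pi) / 2 := by
    rintro x ⟨hx0, hx1⟩ y ⟨hy0, hy1⟩ hxy
    rcases hxy.lt_or_gt with h | h
    · refine ⟨1, Or.inl rfl, by linarith, ?_, ?_⟩
      · rw [arg_one_sub_exp_of_pos (by linarith) (by linarith)]; ring
      · rw [arg_one_sub_exp_of_neg (by linarith) (by linarith)]; ring
    · refine ⟨-1, Or.inr rfl, by linarith, ?_, ?_⟩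
      · rw [arg_one_sub_exp_of_neg (by linarith) (by linarith)]; ring
      · rw [arg_one_sub_exp_of_pos (by linarith) (by linarith)]; ring
  by_cases hac : a = c
  · simp [hac]
  by_cases hbc : b = c
  · simp [hbc]
  by_cases had : a = d
  · simp [had]
  by_cases hbd : b = d
  · simp [hbd]
  obtain ⟨σ₁, s1, p1, v1, w1⟩ := hval a ha c hc hac
  obtain ⟨σ₂, s2, p2, v2, w2⟩ := hval b hb c hc hbc
  obtain ⟨σ₃, s3, p3, v3, w3⟩ := hval a ha d hd had
  obtain ⟨σ₄, s4, p4, v4, w4⟩ := hval b hb d hd hbd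
  rw [v1, v3] at ea
  rw [v2, v4] at eb
  rw [w1, w2] at ec
  rw [w3, w4] at ed
  -- Around the square the angles a, b, c, d cancel and only the signs remain. Then σ₂ + σ₃ = σ₁ +
  -- σ₄ with all signs ±1, so their product is 1.
  have hsum : (σ₃ - σ₁ - σ₄ + σ₂) * Real.pi = 0 := by linarith
  have hsum' : σ₃ - σ₁ - σ₄ + σ₂ = 0 := by
    rcases mul_eq_zero.1 hsum with h | h
    · exact h
    · exact absurd h Real.pi_ne_zero
  have hprod : σ₁ * σ₂ * (σ₃ * σ₄) = 1 := by
    rcases s1 with rfl | rfl <;> rcases s2 with rfl | rfl <;> rcases s3 with rfl | rfl <;>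
      rcases s4 with rfl | rfl <;> first | (norm_num; done) | norm_num at hsum'
  have := mul_pos (mul_pos p1 p2) (mul_pos p3 p4)
  calc (0 : ℝ) ≤ _ := this.le
    _ = (σ₁ * σ₂ * (σ₃ * σ₄)) * ((c - a) * (c - b) * ((d - a) * (d - b))) := by ring
    _ = _ := by rw [hprod, one_mul]

/-- With the vertices in the order given by `θ`, no two edges of `G` have alternating ends. -/
def Noncrossing {V : Type*} (θ : V → ℝ) (G : SimpleGraph V) : Prop :=
  ∀ a b c d, G.Adj a b → G.Adj c d →
    0 ≤ (θ c - θ a) * (θ c - θ b) * ((θ d - θ a) * (θ d - θ b))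

-- Angles are measured from `o` in [0, 2π), so `o` gets angle 0 and comes first. This free choice of
-- starting point is used for the hub of the fan.
open Complex in
theorem OuterplanarDrawing.exists_noncrossing {V : Type*} {G : SimpleGraph V}
    (P : OuterplanarDrawing G) (o : V) :
    ∃ θ : V → ℝ, Function.Injective θ ∧ Noncrossing θ G ∧ ∀ v, θ o ≤ θ v := by
  obtain ⟨ω, hω⟩ : ∃ ω : ℝ, P.point o = exp (ω * I) := by
    refine ⟨arg (P.point o), ?_⟩
    have := norm_mul_exp_arg_mul_I (P.point o)
    rw [P.norm_point, ofReal_one, one_mul] at this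
    exact this.symm
  have hθ : ∀ v, ∃ θ ∈ Set.Ico 0 (2 * Real.pi),
      exp (-(ω * I)) * P.point v = exp ((θ : ℝ) * I) := by
    intro v
    refine ⟨toIcoMod Real.two_pi_pos 0 (arg (P.point v) - ω), ?_, ?_⟩
    · simpa using toIcoMod_mem_Ico Real.two_pi_pos 0 (arg (P.point v) - ω)
    · have h1 := norm_mul_exp_arg_mul_I (P.point v)
      rw [P.norm_point, ofReal_one, one_mul] at h1
      nth_rewrite 1 [← h1]
      rw [← exp_add, toIcoMod, exp_eq_exp_iff_exists_int]
      refine ⟨toIcoDiv Real.two_pi_pos 0 (arg (P.point v) - ω), ?_⟩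
      simp only [zsmul_eq_mul]
      push_cast
      ring
  choose θ hθ hexp using hθ
  have hne : exp (-(ω * I)) ≠ 0 := exp_ne_zero _
  have hnorm : ‖exp (-(ω * I))‖ = 1 := by
    rw [show -((ω : ℂ) * I) = ((-ω : ℝ) : ℂ) * I by push_cast; ring, norm_exp_ofReal_mul_I]
  have hinj : Function.Injective θ := by
    intro u v huv
    apply P.point_injective
    apply mul_left_cancel₀ hne
    rw [hexp, hexp, huv]
  refine ⟨θ, hinj, ?_, ?_⟩
  · have main : ∀ e f : G.edgeSet, (∀ v, v ∈ e.1 → v ∉ f.1) → ∃ a b c d,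
        e.1 = s(a, b) ∧ f.1 = s(c, d) ∧
          0 ≤ (θ c - θ a) * (θ c - θ b) * ((θ d - θ a) * (θ d - θ b)) := by
      intro e f hdisj
      have hends : ∀ e : G.edgeSet, ∃ a b, e.1 = s(a, b) ∧ P.curve e 0 = P.point a ∧
          P.curve e 1 = P.point b := by
        intro e
        obtain ⟨⟨a, b⟩, hab⟩ := Sym2.mk_surjective e.1
        have h := P.curve_ends e
        rw [← hab] at h
        change s(_, _) = s(P.point a, P.point b) at h
        rcases Sym2.eq_iff.1 h with h | h
        · exact ⟨a, b, hab.symm, h⟩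
        · exact ⟨b, a, by rw [← hab]; exact Sym2.eq_swap, h⟩
      obtain ⟨a, b, hab, ha, hb⟩ := hends e
      obtain ⟨c, d, hcd, hc, hd⟩ := hends f
      have hef : e ≠ f := by
        rintro rfl
        exact hdisj a (by simp [hab]) (by simp [hab])
      refine ⟨a, b, c, d, hab, hcd, ?_⟩
      -- `projIcc` extends the curves to all of ℝ, constantly outside the unit interval.
      have hcont : ∀ e : G.edgeSet, Continuous fun t : ℝ =>
          exp (-(ω * I)) * P.curve e (Set.projIcc 0 1 zero_le_one t) := fun e =>
        continuous_const.mul ((P.curve_continuous e).comp continuous_projIcc)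
      have hle : ∀ (e : G.edgeSet) (t : ℝ),
          ‖exp (-(ω * I)) * P.curve e (Set.projIcc 0 1 zero_le_one t)‖ ≤ 1 := fun e t => by
        rw [norm_mul, hnorm, one_mul]
        exact P.norm_curve_le e _
      refine noncrossing_of_paths_disjoint (hcont e) (hcont f) (hle e) (hle f) ?_
        (hθ a) (hθ b) (hθ c) (hθ d) ?_ ?_ ?_ ?_
      · intro s t hst
        obtain ⟨v, hv, hv', -⟩ := P.eq_point_of_curve_eq_curve e f _ _ hef
          (mul_left_cancel₀ hne hst)
        exact hdisj v hv hv'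
      · rw [Set.projIcc_left, ← hexp, ← ha]; rfl
      · rw [Set.projIcc_right, ← hexp, ← hb]; rfl
      · rw [Set.projIcc_left, ← hexp, ← hc]; rfl
      · rw [Set.projIcc_right, ← hexp, ← hd]; rfl
    intro a b c d hab hcd
    by_cases hdisj : ∀ v, v ∈ s(a, b) → v ∉ s(c, d)
    · obtain ⟨a', b', c', d', h1, h2, h3⟩ :=
        main ⟨s(a, b), hab⟩ ⟨s(c, d), hcd⟩ hdisj
      rcases Sym2.eq_iff.1 h1 with ⟨rfl, rfl⟩ | ⟨rfl, rfl⟩ <;>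
        rcases Sym2.eq_iff.1 h2 with ⟨rfl, rfl⟩ | ⟨rfl, rfl⟩ <;> linarith
    -- With a common end, one factor of the product vanishes.
    · push Not at hdisj
      obtain ⟨v, hv, hv'⟩ := hdisj
      rw [Sym2.mem_iff] at hv hv'
      rcases hv with rfl | rfl <;> rcases hv' with rfl | rfl <;> simp
  · intro v
    have : θ o = 0 := by
      have h := hexp o
      rw [hω, ← exp_add, neg_add_cancel, exp_zero] at h
      obtain ⟨n, hn⟩ := exp_eq_one_iff.1 h.symm
      have h2 : θ o = n * (2 * Real.pi) := by
        have := congrArg Complex.im hn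
        simpa using this
      obtain ⟨h3, h4⟩ := hθ o
      rw [h2] at h3 h4 ⊢
      have h5 : (n : ℝ) < 1 := by
        by_contra hc
        push Not at hc
        nlinarith [Real.pi_pos]
      have h6 : (-1 : ℝ) < n := by
        by_contra hc
        push Not at hc
        nlinarith [Real.pi_pos]
      have : n = 0 := by
        have h5' : n < 1 := by exact_mod_cast h5
        have h6' : -1 < n := by exact_mod_cast h6
        omega
      simp [this]
    rw [this]
    exact (hθ v).1

/-! ### Geometry: straight-chord drawings of noncrossing graphs. -/

/-- The rational parametrization of the unit circle. -/
noncomputable def circlePoint (x : ℝ) : ℂ :=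
  ⟨(1 - x ^ 2) / (1 + x ^ 2), 2 * x / (1 + x ^ 2)⟩

/-- Twice the signed area of the triangle `p, q, z`. -/
def signedArea (p q z : ℂ) : ℝ :=
  (q.re - p.re) * (z.im - p.im) - (q.im - p.im) * (z.re - p.re)

theorem norm_circlePoint (x : ℝ) : ‖circlePoint x‖ = 1 := by
  have h : (1 + x ^ 2 : ℝ) ≠ 0 := by positivity
  rw [← sq_eq_sq₀ (norm_nonneg _) zero_le_one, Complex.sq_norm, Complex.normSq_apply]
  simp only [circlePoint]
  field_simp
  ring

/-- The first factor is positive, so the side of a chord on which a point of the circle lies is read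
off from the order of the parameters. -/
theorem signedArea_circlePoint (a b x : ℝ) :
    signedArea (circlePoint a) (circlePoint b) (circlePoint x) =
      4 / ((1 + a ^ 2) * (1 + b ^ 2) * (1 + x ^ 2)) * (b - a) * ((x - a) * (x - b)) := by
  have h : ∀ x : ℝ, (1 + x ^ 2 : ℝ) ≠ 0 := fun x => by positivity
  have ha := h a
  have hb := h b
  have hx := h x
  simp only [signedArea, circlePoint]
  field_simp
  ring

theorem circlePoint_injective : Function.Injective circlePoint := by
  intro x y h
  -- Stereographic projection from -1 recovers the parameter.
  have h1 : ∀ x, (circlePoint x).im / (1 + (circlePoint x).re) = x := fun x => by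
    have hx : (1 + x ^ 2 : ℝ) ≠ 0 := by positivity
    have : 1 + (1 - x ^ 2) / (1 + x ^ 2) = 2 / (1 + x ^ 2) := by field_simp; ring
    simp only [circlePoint, this]
    field_simp
  rw [← h1 x, ← h1 y, h]

/-- The chord from `circlePoint a` to `circlePoint b`. -/
noncomputable def chord (a b t : ℝ) : ℂ :=
  (1 - t : ℝ) * circlePoint a + (t : ℝ) * circlePoint b

theorem signedArea_chord (p q : ℂ) (a b t : ℝ) :
    signedArea p q (chord a b t) =
      (1 - t) * signedArea p q (circlePoint a) + t * signedArea p q (circlePoint b) := by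
  simp only [signedArea, chord, Complex.add_re, Complex.add_im, Complex.re_ofReal_mul,
    Complex.im_ofReal_mul]
  ring

theorem signedArea_chord_self (a b t : ℝ) :
    signedArea (circlePoint a) (circlePoint b) (chord a b t) = 0 := by
  rw [signedArea_chord, signedArea_circlePoint, signedArea_circlePoint]
  ring

/-- If a point of the circle is on a chord then it is an end of the chord. -/
theorem eq_or_eq_of_circlePoint_eq_chord {a b x t : ℝ} (hab : a ≠ b)
    (h : circlePoint x = chord a b t) : x = a ∨ x = b := by
  have h1 := signedArea_chord_self a b t
  rw [← h, signedArea_circlePoint] at h1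
  have h2 : 4 / ((1 + a ^ 2) * (1 + b ^ 2) * (1 + x ^ 2)) * (b - a) ≠ 0 :=
    mul_ne_zero (by positivity) (sub_ne_zero.2 hab.symm)
  rcases mul_eq_zero.1 ((mul_eq_zero.1 h1).resolve_left h2) with h | h
  · exact Or.inl (sub_eq_zero.1 h)
  · exact Or.inr (sub_eq_zero.1 h)

/-- Two different chords whose ends do not alternate meet at most in a common end. -/
theorem exists_common_end_of_chord_eq_chord {a b c d s t : ℝ} (hab : a ≠ b)
    (ht : t ∈ Set.Icc (0 : ℝ) 1) (hne : s(a, b) ≠ s(c, d))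
    (hnc : 0 ≤ (c - a) * (c - b) * ((d - a) * (d - b))) (h : chord a b s = chord c d t) :
    ∃ x, (x = a ∨ x = b) ∧ (x = c ∨ x = d) ∧ chord c d t = circlePoint x := by
  have h1 := signedArea_chord_self a b s
  rw [h, signedArea_chord, signedArea_circlePoint, signedArea_circlePoint] at h1
  have hK : ∀ x : ℝ, 0 < 4 / ((1 + a ^ 2) * (1 + b ^ 2) * (1 + x ^ 2)) := fun x => by positivity
  set K := 4 / ((1 + a ^ 2) * (1 + b ^ 2) * (1 + c ^ 2)) with hKc
  set M := 4 / ((1 + a ^ 2) * (1 + b ^ 2) * (1 + d ^ 2)) with hMd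
  have hKp : 0 < K := hK c
  have hMp : 0 < M := hK d
  -- The signed area relative to the first chord is affine along the second and vanishes at the
  -- common point. Since the ends c, d are not strictly on opposite sides, the point is an end or
  -- both ends lie on the first chord.
  have h2 : (1 - t) * (K * ((c - a) * (c - b))) + t * (M * ((d - a) * (d - b))) = 0 := by
    have : (b - a) * ((1 - t) * (K * ((c - a) * (c - b))) + t * (M * ((d - a) * (d - b)))) = 0 := by
      linarith
    exact (mul_eq_zero.1 this).resolve_left (sub_ne_zero.2 hab.symm)
  by_cases hc : (c - a) * (c - b) = 0
  · have hc' : c = a ∨ c = b := (mul_eq_zero.1 hc).imp sub_eq_zero.1 sub_eq_zero.1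
    by_cases hd : (d - a) * (d - b) = 0
    · have hd' : d = a ∨ d = b := (mul_eq_zero.1 hd).imp sub_eq_zero.1 sub_eq_zero.1
      rcases hc' with rfl | rfl <;> rcases hd' with rfl | rfl
      · refine ⟨_, Or.inl rfl, Or.inl rfl, ?_⟩
        apply Complex.ext <;> simp [chord] <;> ring
      · exact absurd rfl hne
      · exact absurd Sym2.eq_swap hne
      · refine ⟨_, Or.inr rfl, Or.inl rfl, ?_⟩
        apply Complex.ext <;> simp [chord] <;> ring
    · rw [hc, mul_zero, mul_zero, zero_add] at h2
      have ht0 : t = 0 := (mul_eq_zero.1 h2).resolve_right (mul_ne_zero hMp.ne' hd)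
      exact ⟨c, hc', Or.inl rfl, by simp [chord, ht0]⟩
  · by_cases hd : (d - a) * (d - b) = 0
    · have hd' : d = a ∨ d = b := (mul_eq_zero.1 hd).imp sub_eq_zero.1 sub_eq_zero.1
      rw [hd, mul_zero, mul_zero, add_zero] at h2
      have ht1 : 1 - t = 0 := (mul_eq_zero.1 h2).resolve_right (mul_ne_zero hKp.ne' hc)
      have ht1' : t = 1 := by linarith
      exact ⟨d, hd', Or.inr rfl, by simp [chord, ht1']⟩
    · exfalso
      obtain ⟨ht0, ht1⟩ := ht
      have hpos : 0 < (c - a) * (c - b) * ((d - a) * (d - b)) :=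
        lt_of_le_of_ne hnc (mul_ne_zero hc hd).symm
      generalize (c - a) * (c - b) = X at *
      generalize (d - a) * (d - b) = Y at *
      have key : (1 - t) * K * X ^ 2 + t * M * (X * Y) = 0 := by linear_combination X * h2
      have e1 : 0 ≤ (1 - t) * K * X ^ 2 := by
        have : 0 ≤ 1 - t := by linarith
        positivity
      have e2 : 0 ≤ t * M * (X * Y) := by positivity
      have e3 : t = 0 := by
        by_contra h0
        have : 0 < t * M * (X * Y) := by positivity
        linarith
      subst e3
      have : 0 < (1 - 0) * K * X ^ 2 := by
        rw [sub_zero, one_mul]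
        positivity
      linarith

theorem chord_injective {a b : ℝ} (hab : a ≠ b) : Function.Injective (chord a b) := by
  intro s t h
  have h1 : ((s - t : ℝ) : ℂ) * (circlePoint b - circlePoint a) = 0 := by
    simp only [chord] at h
    push_cast at h ⊢
    linear_combination h
  rcases mul_eq_zero.1 h1 with h2 | h2
  · exact sub_eq_zero.1 (by exact_mod_cast h2)
  · exact absurd (circlePoint_injective (sub_eq_zero.1 h2)).symm hab

theorem norm_chord_le {a b t : ℝ} (ht : t ∈ Set.Icc (0 : ℝ) 1) : ‖chord a b t‖ ≤ 1 := by
  obtain ⟨h0, h1⟩ := ht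
  refine (norm_add_le _ _).trans ?_
  rw [norm_mul, norm_mul, norm_circlePoint, norm_circlePoint, Complex.norm_real,
    Complex.norm_real, Real.norm_of_nonneg h0, Real.norm_of_nonneg (by linarith)]
  linarith

/-- A graph without alternating edges can be drawn with straight chords. -/
theorem Noncrossing.isOuterplanar {V : Type*} {G : SimpleGraph V} {θ : V → ℝ}
    (hθ : Function.Injective θ) (h : Noncrossing θ G) : IsOuterplanar G := by
  have hout : ∀ e : G.edgeSet, ∃ p : V × V, e.1 = s(p.1, p.2) := fun e =>
    (Sym2.mk_surjective e.1).imp fun _ h => h.symm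
  choose p hp using hout
  have hadj : ∀ e, G.Adj (p e).1 (p e).2 := fun e => by
    rw [← SimpleGraph.mem_edgeSet, ← hp]
    exact e.2
  have hpne : ∀ e, θ (p e).1 ≠ θ (p e).2 := fun e h => (hadj e).ne (hθ h)
  have hmem : ∀ e v, v ∈ e.1 ↔ v = (p e).1 ∨ v = (p e).2 := fun e v => by
    rw [hp e, Sym2.mem_iff]
  refine ⟨{
    point := fun v => circlePoint (θ v)
    curve := fun e t => chord (θ (p e).1) (θ (p e).2) t
    point_injective := circlePoint_injective.comp hθ
    curve_continuous := fun e => by unfold chord; fun_prop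
    curve_injective := fun e => (chord_injective (hpne e)).comp Subtype.val_injective
    curve_ends := fun e => ?_
    mem_of_point_eq_curve := fun e v t hv => ?_
    eq_point_of_curve_eq_curve := fun e f s t hef hst => ?_
    norm_point := fun v => norm_circlePoint _
    norm_curve_le := fun e t => norm_chord_le t.2 }⟩
  · refine Eq.trans ?_ (congrArg _ (hp e)).symm
    simp [chord]
  · rw [hmem]
    exact (eq_or_eq_of_circlePoint_eq_chord (hpne e) hv).imp (@hθ _ _) (@hθ _ _)
  · have hne : s(θ (p e).1, θ (p e).2) ≠ s(θ (p f).1, θ (p f).2) := fun h => by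
      apply hef
      apply Subtype.ext
      rw [hp e, hp f]
      exact Sym2.map.injective hθ h
    obtain ⟨x, hx1, hx2, hx⟩ := exists_common_end_of_chord_eq_chord (hpne e) t.2 hne
      (h _ _ _ _ (hadj e) (hadj f)) hst
    have : ∃ v, x = θ v := by rcases hx1 with h | h <;> exact ⟨_, h⟩
    obtain ⟨v, rfl⟩ := this
    refine ⟨v, (hmem e v).2 (hx1.imp (@hθ _ _) (@hθ _ _)),
      (hmem f v).2 (hx2.imp (@hθ _ _) (@hθ _ _)), hst.trans hx⟩

/-! ### Upper bound: a Hamiltonian path and its blocks of two. -/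

/-- In a maximal outerplanar graph the vertices can be enumerated so that consecutive vertices are
adjacent. -/
theorem IsMaximalOuterplanar.exists_hamiltonian_path {V : Type*} [Fintype V] [Nonempty V]
    {G : SimpleGraph V} (hG : IsMaximalOuterplanar G) :
    ∃ e : Fin (Fintype.card V) ≃ V,
      ∀ i j : Fin (Fintype.card V), (j : ℕ) = i + 1 → G.Adj (e i) (e j) := by
  obtain ⟨⟨P⟩, hmax⟩ := hG
  obtain ⟨θ, hinj, hnc, -⟩ := P.exists_noncrossing (Classical.arbitrary V)
  obtain ⟨e, he⟩ : ∃ e : Fin (Fintype.card V) ≃ V, StrictMono fun i => θ (e i) := by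
    let _ := LinearOrder.lift' θ hinj
    let e := Fintype.orderIsoFinOfCardEq V rfl
    exact ⟨e.toEquiv, fun i j hij => e.strictMono hij⟩
  refine ⟨e, fun i j hij => ?_⟩
  let G' : SimpleGraph V := G ⊔ SimpleGraph.edge (e i) (e j)
  have hij' : e i ≠ e j := fun h => by
    have := congrArg Fin.val (e.injective h)
    omega
  -- No vertex lies strictly between two consecutive ones, so no edge can alternate with the new
  -- one.
  have hcons : ∀ x, 0 ≤ (θ x - θ (e i)) * (θ x - θ (e j)) := by
    intro x
    obtain ⟨k, rfl⟩ := e.surjective x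
    rcases le_or_gt k i with h | h
    · have h1 := he.monotone h
      have h2 := he.monotone (show k ≤ j by rw [Fin.le_def] at *; omega)
      exact mul_nonneg_of_nonpos_of_nonpos (sub_nonpos.2 h1) (sub_nonpos.2 h2)
    · have h1 := he.monotone h.le
      have h2 := he.monotone (show j ≤ k by rw [Fin.le_def]; rw [Fin.lt_def] at h; omega)
      exact mul_nonneg (sub_nonneg.2 h1) (sub_nonneg.2 h2)
  have hedge : ∀ a b, (SimpleGraph.edge (e i) (e j)).Adj a b →
      ∀ x, 0 ≤ (θ x - θ a) * (θ x - θ b) := by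
    intro a b hab x
    rw [SimpleGraph.edge_adj] at hab
    rcases hab.1 with ⟨rfl, rfl⟩ | ⟨rfl, rfl⟩
    · exact hcons x
    · rw [mul_comm]
      exact hcons x
  have hnc' : Noncrossing θ G' := by
    intro a b c d hab hcd
    rcases hab with hab | hab
    · rcases hcd with hcd | hcd
      · exact hnc a b c d hab hcd
      · have := mul_nonneg (hedge c d hcd a) (hedge c d hcd b)
        linarith
    · exact mul_nonneg (hedge a b hab c) (hedge a b hab d)
  have hle := hmax (hnc'.isOuterplanar hinj) le_sup_left
  exact hle (Or.inr (by rw [SimpleGraph.edge_adj]; exact ⟨Or.inl ⟨rfl, rfl⟩, hij'⟩))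

theorem dirDomNumber_le_card {V : Type*} {D : Digraph V} {S : Finset V}
    (h : IsDirectedDominating D S) : dirDomNumber D ≤ S.card :=
  Nat.sInf_le ⟨S, h, rfl⟩

/-- If consecutive vertices are adjacent in an enumeration, then the tails of every second arc
dominate. -/
theorem dirDomNumber_le_of_hamiltonian_path {V : Type*} {n : ℕ} {G : SimpleGraph V}
    {D : Digraph V} (hD : IsOrientation D G) (e : Fin n ≃ V)
    (he : ∀ i j : Fin n, (j : ℕ) = i + 1 → G.Adj (e i) (e j)) :
    dirDomNumber D ≤ (n + 1) / 2 := by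
  classical
  -- Block k consists of positions 2k and 2k + 1; for odd n the last block is a single vertex.
  have hv : ∀ k : Fin ((n + 1) / 2), ∃ v, ∀ i : Fin n, (i : ℕ) / 2 = k →
      e i = v ∨ D.Adj v (e i) := by
    intro k
    have hk := k.2
    by_cases h : 2 * (k : ℕ) + 1 < n
    · let i₀ : Fin n := ⟨2 * k, by omega⟩
      let i₁ : Fin n := ⟨2 * k + 1, h⟩
      have hi : ∀ i : Fin n, (i : ℕ) / 2 = k → i = i₀ ∨ i = i₁ := fun i hi => by
        simp only [i₀, i₁, Fin.ext_iff]
        omega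
      rcases (hD.adj_iff _ _).1 (he i₀ i₁ rfl) with h | h
      · exact ⟨e i₀, fun i hik => by rcases hi i hik with rfl | rfl; exacts [Or.inl rfl, Or.inr h]⟩
      · exact ⟨e i₁, fun i hik => by rcases hi i hik with rfl | rfl; exacts [Or.inr h, Or.inl rfl]⟩
    · refine ⟨e ⟨2 * k, by omega⟩, fun i hik => Or.inl ?_⟩
      congr 1
      apply Fin.ext
      have := i.2
      change (i : ℕ) = 2 * k
      omega
  choose v hv using hv
  have hdom : IsDirectedDominating D (Finset.univ.image v) := by
    intro u hu
    obtain ⟨i, rfl⟩ := e.surjective u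
    have hi := i.2
    let k : Fin ((n + 1) / 2) := ⟨(i : ℕ) / 2, by omega⟩
    have hk : v k ∈ Finset.univ.image v := Finset.mem_image_of_mem v (Finset.mem_univ k)
    rcases hv k i rfl with h | h
    · exact absurd (h ▸ hk) hu
    · exact ⟨_, hk, h⟩
  calc dirDomNumber D ≤ _ := dirDomNumber_le_card hdom
    _ ≤ (Finset.univ : Finset (Fin ((n + 1) / 2))).card := Finset.card_image_le
    _ = (n + 1) / 2 := by simp

theorem IsMaximalOuterplanar.upperDirDomNumber_le {V : Type*} [Fintype V] [Nonempty V]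
    {G : SimpleGraph V} (hG : IsMaximalOuterplanar G) :
    upperDirDomNumber G ≤ (Fintype.card V + 1) / 2 := by
  obtain ⟨e, he⟩ := hG.exists_hamiltonian_path
  obtain ⟨D, hD, h⟩ := (isGreatest_upperDirDomNumber G).1
  rw [← h]
  exact dirDomNumber_le_of_hamiltonian_path hD e he

/-! ### Lower bound: the fan and an extremal orientation. -/

/-- The fan: vertex `0` is joined to all vertices of the path `1, …, n - 1`. -/
def fan (n : ℕ) : SimpleGraph (Fin n) where
  Adj i j := i ≠ j ∧ ((i : ℕ) = 0 ∨ (j : ℕ) = 0 ∨ (i : ℕ) + 1 = j ∨ (j : ℕ) + 1 = i)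
  symm := ⟨fun _ _ h => ⟨h.1.symm, by tauto⟩⟩
  loopless := ⟨fun _ h => h.1 rfl⟩

/-- The orientation of the fan in which the path runs from `n - 1` down to `1`, and the arcs at `0`
go from odd vertices and to even vertices. -/
def fanDigraph (n : ℕ) : Digraph (Fin n) where
  Adj i j := ((i : ℕ) = 0 ∧ (j : ℕ) ≠ 0 ∧ (j : ℕ) % 2 = 0) ∨ ((j : ℕ) = 0 ∧ (i : ℕ) % 2 = 1) ∨
    ((j : ℕ) ≠ 0 ∧ (i : ℕ) = j + 1)

theorem isOrientation_fanDigraph (n : ℕ) : IsOrientation (fanDigraph n) (fan n) where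
  adj_iff u v := by
    simp only [fan, fanDigraph, ne_eq, Fin.ext_iff]
    omega
  asymm u v := by
    simp only [fanDigraph]
    omega

theorem noncrossing_fan (n : ℕ) : Noncrossing (fun i : Fin n => ((i : ℕ) : ℝ)) (fan n) := by
  have hcons : ∀ a b x : ℕ, a + 1 = b ∨ b + 1 = a → 0 ≤ ((x : ℝ) - a) * (x - b) := by
    have hsucc : ∀ a x : ℕ, 0 ≤ ((x : ℝ) - a) * (x - (a + 1 : ℕ)) := by
      intro a x
      rcases Nat.lt_or_ge a x with h | h
      · have h1 : (a : ℝ) ≤ x := by exact_mod_cast h.le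
        have h2 : ((a + 1 : ℕ) : ℝ) ≤ x := by exact_mod_cast h
        exact mul_nonneg (sub_nonneg.2 h1) (sub_nonneg.2 h2)
      · have h1 : (x : ℝ) ≤ a := by exact_mod_cast h
        have h2 : (x : ℝ) ≤ ((a + 1 : ℕ) : ℝ) := by exact_mod_cast h.trans a.le_succ
        exact mul_nonneg_of_nonpos_of_nonpos (sub_nonpos.2 h1) (sub_nonpos.2 h2)
    rintro a b x (rfl | rfl)
    · exact hsucc a x
    · rw [mul_comm]
      exact hsucc b x
  rintro a b c d ⟨-, hab⟩ ⟨-, hcd⟩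
  by_cases h1 : (a : ℕ) + 1 = b ∨ (b : ℕ) + 1 = a
  · exact mul_nonneg (hcons a b c h1) (hcons a b d h1)
  by_cases h2 : (c : ℕ) + 1 = d ∨ (d : ℕ) + 1 = c
  · have := mul_nonneg (hcons c d a h2) (hcons c d b h2)
    linarith
  have h1' : (a : ℕ) = 0 ∨ (b : ℕ) = 0 := by tauto
  have h2' : (c : ℕ) = 0 ∨ (d : ℕ) = 0 := by tauto
  rcases h1' with h | h <;> rcases h2' with h' | h' <;> simp [h, h']

theorem isOuterplanar_fan (n : ℕ) : IsOuterplanar (fan n) :=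
  (noncrossing_fan n).isOuterplanar fun _ _ h => Fin.ext (Nat.cast_injective h)

/-- A fan with an additional edge contains a wheel and is not outerplanar. -/
theorem isMaximalOuterplanar_fan {n : ℕ} (hn : 1 ≤ n) : IsMaximalOuterplanar (fan n) := by
  refine ⟨isOuterplanar_fan n, ?_⟩
  rintro H ⟨P⟩ hle
  obtain ⟨θ, hinj, hnc, hmin⟩ := P.exists_noncrossing ⟨0, hn⟩
  -- The hub precedes u and v, so a spoke ending strictly between them would cross the edge uv.
  have hbetween : ∀ u v w : Fin n, (u : ℕ) ≠ 0 → (v : ℕ) ≠ 0 → (w : ℕ) ≠ 0 → H.Adj u v →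
      0 ≤ (θ w - θ u) * (θ w - θ v) := by
    intro u v w hu hv hw huv
    have hlt : ∀ x : Fin n, (x : ℕ) ≠ 0 → θ ⟨0, hn⟩ < θ x := fun x hx =>
      lt_of_le_of_ne (hmin x) fun h => hx (congrArg Fin.val (hinj h)).symm
    have hadj : H.Adj ⟨0, hn⟩ w := hle ⟨fun h => hw (congrArg Fin.val h).symm, Or.inl rfl⟩
    exact nonneg_of_mul_nonneg_right (hnc _ _ _ _ huv hadj)
      (mul_pos_of_neg_of_neg (sub_neg.2 (hlt u hu)) (sub_neg.2 (hlt v hv)))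
  -- The extra edge closes the cycle x, x + 1, …, y, which avoids the hub. Let m be its vertex with
  -- largest angle and p, q the neighbours of m on it. Neither of p, q can lie strictly between m
  -- and the other, so their angles coincide.
  have key : ∀ x y : Fin n, (x : ℕ) ≠ 0 → (x : ℕ) + 1 < y → ¬ H.Adj x y := by
    intro x y hx hxy hadj
    obtain ⟨m, hm, hmax⟩ := (Finset.Icc x y).exists_max_image θ
      ⟨x, by rw [Finset.mem_Icc, Fin.le_def, Fin.le_def]; omega⟩
    simp only [Finset.mem_Icc, Fin.le_def] at hm hmax
    have hstep : ∀ i j : Fin n, (i : ℕ) + 1 = j ∨ (j : ℕ) + 1 = i → H.Adj i j := fun i j h =>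
      hle ⟨fun h' => by rw [h'] at h; omega, by tauto⟩
    obtain ⟨p, q, hp, hq, hpq, hmp, hmq⟩ : ∃ p q : Fin n, ((x : ℕ) ≤ p ∧ (p : ℕ) ≤ y) ∧
        ((x : ℕ) ≤ q ∧ (q : ℕ) ≤ y) ∧ p ≠ q ∧ H.Adj m p ∧ H.Adj m q := by
      have hy := y.2
      by_cases h1 : m = x
      · subst h1
        refine ⟨⟨m + 1, by omega⟩, y, ?_, ?_, ?_, hstep _ _ (Or.inl rfl), hadj⟩ <;>
          (try simp only [ne_eq, Fin.ext_iff]) <;> omega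
      · have h1' : (m : ℕ) ≠ x := fun h => h1 (Fin.ext h)
        have hp : H.Adj m ⟨m - 1, by omega⟩ := hstep _ _ (Or.inr (Nat.sub_add_cancel (by omega)))
        by_cases h2 : m = y
        · subst h2
          refine ⟨_, x, ?_, ?_, ?_, hp, hadj.symm⟩ <;> (try simp only [ne_eq, Fin.ext_iff]) <;> omega
        · have h2' : (m : ℕ) ≠ y := fun h => h2 (Fin.ext h)
          refine ⟨_, ⟨m + 1, by omega⟩, ?_, ?_, ?_, hp, hstep _ _ (Or.inl rfl)⟩ <;>
            (try simp only [ne_eq, Fin.ext_iff]) <;> omega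
    have hlt : ∀ r : Fin n, ((x : ℕ) ≤ r ∧ (r : ℕ) ≤ y) → H.Adj m r → θ r < θ m := fun r hr hmr =>
      lt_of_le_of_ne (hmax r hr) fun h => hmr.ne (hinj h).symm
    have hp' := hlt p hp hmp
    have hq' := hlt q hq hmq
    have e1 := nonpos_of_mul_nonneg_right
      (hbetween m p q (by omega) (by omega) (by omega) hmp) (sub_neg.2 hq')
    have e2 := nonpos_of_mul_nonneg_right
      (hbetween m q p (by omega) (by omega) (by omega) hmq) (sub_neg.2 hp')
    exact hpq (hinj (by linarith))
  intro x y hxy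
  refine ⟨hxy.ne, ?_⟩
  by_contra hcon
  have hne : (x : ℕ) ≠ y := fun h => hxy.ne (Fin.ext h)
  rcases Nat.lt_or_ge x y with h | h
  · exact key x y (by omega) (by omega) hxy
  · exact key y x (by omega) (by omega) hxy.symm

theorem le_card_of_isDirectedDominating_fanDigraph {n : ℕ} (hn : 1 ≤ n) {S : Finset (Fin n)}
    (hS : IsDirectedDominating (fanDigraph n) S) : (n + 1) / 2 ≤ S.card := by
  classical
  have hdom : ∀ u (hu : u < n), (⟨u, hu⟩ : Fin n) ∈ S ∨ ∃ v ∈ S,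
      ((v : ℕ) = 0 ∧ u ≠ 0 ∧ u % 2 = 0) ∨ (u = 0 ∧ (v : ℕ) % 2 = 1) ∨ (u ≠ 0 ∧ (v : ℕ) = u + 1) :=
    fun u hu => or_iff_not_imp_left.2 fun h => hS _ h
  -- The fibres of g are {0}, {1, 2}, {3, 4}, …. An odd vertex 2k - 1 can be dominated from outside
  -- only by 2k, so S meets every fibre with 1 ≤ k ≤ n / 2.
  let g : Fin n → ℕ := fun i => ((i : ℕ) + 1) / 2
  have himg : ∀ k, 1 ≤ k → k ≤ n / 2 → k ∈ S.image g := by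
    intro k hk hkn
    rw [Finset.mem_image]
    rcases hdom (2 * k - 1) (by omega) with h | ⟨v, hv, h⟩
    · exact ⟨_, h, by simp only [g]; omega⟩
    · exact ⟨v, hv, by simp only [g]; omega⟩
  by_cases h0 : (⟨0, hn⟩ : Fin n) ∈ S
  · have hsub : Finset.range (n / 2 + 1) ⊆ S.image g := by
      intro k hk
      rw [Finset.mem_range] at hk
      rcases Nat.eq_zero_or_pos k with rfl | hk'
      · exact Finset.mem_image.2 ⟨_, h0, by simp [g]⟩
      · exact himg k hk' (by omega)
    have := (Finset.card_le_card hsub).trans Finset.card_image_le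
    rw [Finset.card_range] at this
    omega
  · have hsub : Finset.Icc 1 (n / 2) ⊆ S.image g := fun k hk => by
      rw [Finset.mem_Icc] at hk
      exact himg k hk.1 hk.2
    have hcard := Finset.card_le_card hsub
    rw [Nat.card_Icc] at hcard
    have hle : (S.image g).card ≤ S.card := Finset.card_image_le
    -- Failure forces n to be odd and S to have exactly one vertex in each of these fibres.
    by_contra hlt
    have hinj : Set.InjOn g S := Finset.card_image_iff.1 (by omega)
    have hne : ∀ v ∈ S, (v : ℕ) ≠ 0 := fun v hv h => h0 (by
      have : v = ⟨0, hn⟩ := Fin.ext h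
      exact this ▸ hv)
    -- Descending induction from n - 1 = 2(n / 2), whose only in-neighbour is the absent hub. If 2i
    -- + 2 is in S then 2i + 1 is not, so nothing in S dominates 2i and it must itself be chosen.
    -- Thus S contains no odd vertex, and the hub is not dominated.
    have heven : ∀ j i, i + j = n / 2 → 1 ≤ i → ∃ v ∈ S, (v : ℕ) = 2 * i := by
      intro j
      induction j with
      | zero =>
        intro i hi hi1
        rcases hdom (2 * i) (by omega) with h | ⟨v, hv, h⟩
        · exact ⟨_, h, rfl⟩
        · have := hne v hv
          have := v.2
          omega
      | succ j ih =>
        intro i hi hi1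
        obtain ⟨w, hw, hwi⟩ := ih (i + 1) (by omega) (by omega)
        rcases hdom (2 * i) (by omega) with h | ⟨v, hv, h⟩
        · exact ⟨_, h, rfl⟩
        · have := hne v hv
          have hvw : v = w := hinj hv hw (by simp only [g]; omega)
          rw [hvw] at h
          omega
    rcases hdom 0 hn with h | ⟨v, hv, h⟩
    · exact h0 h
    · have := v.2
      obtain ⟨w, hw, hwi⟩ := heven (n / 2 - ((v : ℕ) + 1) / 2) (((v : ℕ) + 1) / 2) (by omega)
        (by omega)
      have hvw : v = w := hinj hv hw (by simp only [g]; omega)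
      rw [hvw] at h
      omega

theorem upperDirDomNumber_fan {n : ℕ} (hn : 1 ≤ n) : upperDirDomNumber (fan n) = (n + 1) / 2 := by
  apply le_antisymm
  · have : Nonempty (Fin n) := ⟨⟨0, hn⟩⟩
    simpa using (isMaximalOuterplanar_fan hn).upperDirDomNumber_le
  · obtain ⟨S, hS, hcard⟩ := (isLeast_dirDomNumber (fanDigraph n)).1
    calc (n + 1) / 2 ≤ S.card := le_card_of_isDirectedDominating_fanDigraph hn hS
      _ = dirDomNumber (fanDigraph n) := hcard
      _ ≤ _ := (isGreatest_upperDirDomNumber _).2 ⟨_, isOrientation_fanDigraph n, rfl⟩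

theorem ceil_half (n : ℕ) : ⌈(n : ℚ) / 2⌉₊ = (n + 1) / 2 := by
  apply eq_of_forall_ge_iff
  intro k
  rw [Nat.ceil_le, div_le_iff₀ two_pos]
  norm_cast
  omega

/-- The maximum of the directed domination number over all maximal outerplanar graphs of
order `n` exists and equals `⌈n / 2⌉`. -/
theorem mainTheorem10 (n : ℕ) (hn : 1 ≤ n) :
    IsGreatest
      {k : ℕ | ∃ (V : Type) (_ : Fintype V) (G : SimpleGraph V),
        Fintype.card V = n ∧ IsMaximalOuterplanar G ∧ upperDirDomNumber G = k}
      ⌈(n : ℚ) / 2⌉₊ := by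
  rw [ceil_half]
  refine ⟨⟨Fin n, inferInstance, fan n, Fintype.card_fin n, isMaximalOuterplanar_fan hn,
    upperDirDomNumber_fan hn⟩, ?_⟩
  rintro k ⟨V, _, G, rfl, hG, rfl⟩
  have : Nonempty V := Fintype.card_pos_iff.1 hn
  exact hG.upperDirDomNumber_le
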